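/- **Setting.** Fix $d\in\mathbb N$ and a set $Y$ of values of the auxiliary variable $y$. An IMCA parameter $\theta=(h,T,\lambda,\mu)$ consists of a mixing function $h:\mathbb R^d\to\mathbb R^d$, sufficient statistics $T_i:\mathbb R\to\mathbb R^{k_i}$ and functions $\lambda_i:Y\to\mathbb R^{k_i}$ ($1\le i\le d$, with dimensions $k_i=\dim(T_i)$ that may depend on $i$ and on $\theta$), and a base density $\mu:\mathbb R^d\to\mathbb R$ which is positive almost everywhere but need not factorize. It defines the conditional model $$p_\theta(z\mid y)=\mu(z)\exp\Big(\sum_{i=1}^d T_i(z_i)^{\top}\lambda_i(y)-\Gamma(y)\Big),\qquad x=h(z),$$ where $\Gamma(y)$ is the (finite) log-normalizing constant, for every $y \in Y$; $p_\theta(x\mid y)$ denotes the resulting conditional distribution of $x$. A set $\Theta$ of such parameters (a model) is *strongly identifiable* if, whenever $\theta=(h,T,\lambda,\mu)$ and $\tilde\theta=(\tilde h,\tilde T,\tilde\lambda,\tilde\mu)$ in $\Theta$ satisfy $p_\theta(x\mid y)=p_{\tilde\theta}(x\mid y)$ for all $y\in Y$, there are a permutation $\gamma$ of $\{1,\dots,d\}$,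 invertible (in particular square) matrices $A_i$ and vectors $b_i$ such that, for every $i$ and every $x\in\mathbb R^d$, with $z=h^{-1}(x)$ and $\tilde z=\tilde h^{-1}(x)$, $$T_i(z_i)=A_i\,\tilde T_{\gamma(i)}(\tilde z_{\gamma(i)})+b_i .$$ **Theorem (strong identifiability of IMCA).** Let $\Theta$ be a set of IMCA parameters such that every $(h,T,\lambda,\mu)\in\Theta$ satisfies: 1. $h$ is invertible; 2. each $T_i$ is differentiable and strongly exponential: if $U\subseteq\mathbb R$ and $\eta\in\mathbb R^{k_i}$ are such that $\langle T_i(u),\eta\rangle$ is constant for $u\in U$, then $U$ has Lebesgue measure $0$ or $\eta=0$; 3. with $k=\sum_i k_i$ and $\lambda(y)=(\lambda_1(y),\dots,\lambda_d(y))\in\mathbb R^k$, there are $k+1$ distinct points $y_0,\dots,y_k\in Y$ such that the $k\times k$ matrix $\big(\lambda(y_1)-\lambda(y_0),\dots,\lambda(y_k)-\lambda(y_0)\big)$ is invertible. Assume moreover that one of the following holds: * (a) for every $(h,T,\lambda,\mu)\in\Theta$, each $T_i$ is twice differentiable with $k_i\ge 2$, and $h$ is a $\mathcal D^2$-diffeomorphism,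 i.e. $h$ is invertible, $h$ and $h^{-1}$ are differentiable, and all their second-order cross-derivatives exist (not necessarily continuous); or * (b) for every $(h,T,\lambda,\mu)\in\Theta$, each $T_i$ is scalar ($k_i=1$) and non-monotonic (neither non-decreasing nor non-increasing), and $h$ is a $\mathcal C^1$-diffeomorphism. Then $\Theta$ is strongly identifiable. -/

import Mathlib

open MeasureTheory

noncomputable section

namespace IMCA

/-! ### Regularity of maps of `ℝ^d` -/

/-- `h` is a `D²`-diffeomorphism of `ℝ^d`: it is invertible, it and its inverse are differentiable,
and all second order cross-derivatives `∂²/∂x_t∂x_s`, `s ≠ t`, of it and of its inverse exist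
everywhere (they need not be continuous). -/
def IsD2Diffeomorphism {d : ℕ} (h : (Fin d → ℝ) → (Fin d → ℝ)) : Prop :=
  ∃ g : (Fin d → ℝ) → (Fin d → ℝ),
    Function.LeftInverse g h ∧ Function.RightInverse g h ∧
    Differentiable ℝ h ∧ Differentiable ℝ g ∧
    ∀ s t : Fin d, s ≠ t → ∀ x : Fin d → ℝ,
      LineDifferentiableAt ℝ (fun x' => fderiv ℝ h x' (Pi.single s 1)) x (Pi.single t 1) ∧
      LineDifferentiableAt ℝ (fun x' => fderiv ℝ g x' (Pi.single s 1)) x (Pi.single t 1)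

/-- `h` is a `C¹`-diffeomorphism of `ℝ^d`. -/
def IsC1Diffeomorphism {d : ℕ} (h : (Fin d → ℝ) → (Fin d → ℝ)) : Prop :=
  ∃ g : (Fin d → ℝ) → (Fin d → ℝ),
    Function.LeftInverse g h ∧ Function.RightInverse g h ∧ ContDiff ℝ 1 h ∧ ContDiff ℝ 1 g

/-- The defining property of a strongly exponential univariate family, in terms of its sufficient
statistic `T`: no nontrivial linear combination of the components of `T` is constant on a set of
positive Lebesgue measure. -/
def StronglyExponential {k : ℕ} (T : ℝ → (Fin k → ℝ)) : Prop :=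
  ∀ (U : Set ℝ) (η : Fin k → ℝ),
    (∃ c : ℝ, ∀ u ∈ U, T u ⬝ᵥ η = c) → volume U = 0 ∨ η = 0

/-! ### The model -/

/-- Parameters `(h, T, λ, μ)` of an IMCA model with latent space `ℝ^d` and auxiliary values in `Y`.
The `i`-th sufficient statistic takes values in `ℝ^(dim i)`. -/
structure Parameters (d : ℕ) (Y : Type*) where
  /-- the mixing function `h` -/
  mixing : (Fin d → ℝ) → (Fin d → ℝ)
  /-- the dimensions of the sufficient statistics -/
  dim : Fin d → ℕ
  /-- the sufficient statistics `T_i` -/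
  stat : (i : Fin d) → ℝ → (Fin (dim i) → ℝ)
  /-- the natural parameters `λ_i` -/
  natParam : (i : Fin d) → Y → (Fin (dim i) → ℝ)
  /-- the base density `μ` -/
  base : (Fin d → ℝ) → ℝ

namespace Parameters

variable {d : ℕ} {Y : Type*}

/-- The total dimension `k = ∑ i, dim T_i`. -/
def totalDim (θ : Parameters d Y) : ℕ := ∑ i, θ.dim i

/-- The exponent `∑ i, T_i(z_i)ᵀ λ_i(y)`. -/
def exponent (θ : Parameters d Y) (z : Fin d → ℝ) (y : Y) : ℝ :=
  ∑ i, θ.stat i (z i) ⬝ᵥ θ.natParam i y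

/-- The conditional log-normalizer `Γ(y)`. -/
def logNormalizer (θ : Parameters d Y) (y : Y) : ℝ :=
  Real.log (∫ z, θ.base z * Real.exp (θ.exponent z y))

/-- The conditional latent density `p(z | y) = μ(z) exp (∑ i, T_i(z_i)ᵀ λ_i(y) - Γ(y))`. -/
def latentDensity (θ : Parameters d Y) (y : Y) (z : Fin d → ℝ) : ℝ :=
  θ.base z * Real.exp (θ.exponent z y - θ.logNormalizer y)

/-- The conditional law of the latent variable `z` given `y`. -/
def latentLaw (θ : Parameters d Y) (y : Y) : Measure (Fin d → ℝ) :=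
  volume.withDensity fun z => ENNReal.ofReal (θ.latentDensity y z)

/-- The conditional law of the observation `x = h(z)` given `y`. Two models have the same
conditional densities `p(x | y)` exactly when these laws agree. -/
def observedLaw (θ : Parameters d Y) (y : Y) : Measure (Fin d → ℝ) :=
  (θ.latentLaw y).map θ.mixing

/-- The parameters define an IMCA model: the mixing function and the base density are measurable,
the base density is positive almost everywhere, and the conditional densities are normalizable. -/
def IsModel (θ : Parameters d Y) : Prop :=
  Measurable θ.mixing ∧ Measurable θ.base ∧ (∀ᵐ z, 0 < θ.base z) ∧
    ∀ y, Integrable fun z => θ.base z * Real.exp (θ.exponent z y)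

/-- The concatenation `λ(y) ∈ ℝ^k` of the vectors `λ_i(y)`. -/
def fullNatParam (θ : Parameters d Y) (y : Y) : Fin θ.totalDim → ℝ :=
  fun r => θ.natParam (finSigmaFinEquiv.symm r).1 y (finSigmaFinEquiv.symm r).2

/-- The `k × k` matrix `(λ(y_1) - λ(y_0), …, λ(y_k) - λ(y_0))`. -/
def variabilityMatrix (θ : Parameters d Y) (y : Fin (θ.totalDim + 1) → Y) :
    Matrix (Fin θ.totalDim) (Fin θ.totalDim) ℝ :=
  Matrix.of fun r l => θ.fullNatParam (y l.succ) r - θ.fullNatParam (y 0) r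

/-- The assumptions for weak identifiability. -/
structure WeakAssumptions (θ : Parameters d Y) : Prop where
  isModel : θ.IsModel
  invertible : Function.Bijective θ.mixing
  stronglyExponential : ∀ i, StronglyExponential (θ.stat i)
  differentiable : ∀ i, Differentiable ℝ (θ.stat i)
  variability : ∃ y : Fin (θ.totalDim + 1) → Y,
    Function.Injective y ∧ IsUnit (θ.variabilityMatrix y)

/-- First set of additional assumptions: twice differentiable sufficient statistics of dimension
at least two, and a `D²`-diffeomorphic mixing function. -/
def MultivariateAssumptions (θ : Parameters d Y) : Prop :=
  (∀ i, Differentiable ℝ (θ.stat i) ∧ Differentiable ℝ (deriv (θ.stat i)) ∧ 2 ≤ θ.dim i) ∧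
    IsD2Diffeomorphism θ.mixing

/-- Second set of additional assumptions: scalar non-monotonic sufficient statistics, and a
`C¹`-diffeomorphic mixing function. -/
def ScalarAssumptions (θ : Parameters d Y) : Prop :=
  (∀ i, θ.dim i = 1 ∧ ∀ a : Fin (θ.dim i),
      ¬ Monotone (fun u => θ.stat i u a) ∧ ¬ Antitone (fun u => θ.stat i u a)) ∧
    IsC1Diffeomorphism θ.mixing

/-- `T_i(z_i) = A_i T̃_{γ(i)}(z̃_{γ(i)}) + b_i` for all `i`, for a permutation `γ`, invertible `A_i`
and vectors `b_i`, whenever the latents `z` and `z̃` yield the same observation `x`. The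
invertible matrix `A_i` is given as a linear equivalence, so that in particular
`dim T_i = dim T̃_{γ(i)}`. -/
def StronglyEquivalent (θ θ' : Parameters d Y) : Prop :=
  ∃ γ : Equiv.Perm (Fin d), ∀ i : Fin d,
    ∃ (A : (Fin (θ'.dim (γ i)) → ℝ) ≃ₗ[ℝ] (Fin (θ.dim i) → ℝ)) (b : Fin (θ.dim i) → ℝ),
      ∀ z z' : Fin d → ℝ, θ.mixing z = θ'.mixing z' →
        θ.stat i (z i) = A (θ'.stat (γ i) (z' (γ i))) + b

/-- A model, given as a set `Θ` of admissible parameters, is strongly identifiable if any two of its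
parameters with the same conditional distributions of the observation are strongly equivalent. -/
def StronglyIdentifiable (Θ : Set (Parameters d Y)) : Prop :=
  ∀ θ ∈ Θ, ∀ θ' ∈ Θ, (∀ y, θ.observedLaw y = θ'.observedLaw y) → StronglyEquivalent θ θ'

end Parameters

end IMCA

end

namespace IMCA

open Matrix

/-! ### Sufficient statistics -/

/-! Passing to the likelihood ratio between two values of `y` cancels the base density, so equal
observed laws force equal log-ratios at matching latents, everywhere by continuity (`logRatio_eq`).
The variability condition inverts these linear equations: `T(z) = M T'(z') + b`, and symmetrically
with `M'`; strong exponentiality makes `M` and `M'` mutually inverse (`exists_affine`). It remains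
to see that each block row of `M` has only one nonzero block; `exists_perm_of_block` then yields the
permutation. Let `ψ` send `z'` to `z`. Differentiating in `z'_m` shows that the vectors `M_im
T'_m'(z'_m)`, for all `m`, are multiples of the single vector `T_i'(ψ_i(z'))`. In the multivariate
case two nonzero blocks would confine all these vectors to one line, against the full rank `k_i ≥ 2`
of the block row. In the scalar case `T_i` has a critical point `u`; on the hyperplane `z_i = u`
every `z'_m` with `M_im ≠ 0` is constant, and a diffeomorphism allows only one such coordinate. -/

/-- The concatenation of univariate statistics, evaluated coordinatewise. -/
def concat {d : ℕ} {k : Fin d → ℕ} (T : (i : Fin d) → ℝ → (Fin (k i) → ℝ)) (z : Fin d → ℝ) :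
    (Σ i, Fin (k i)) → ℝ :=
  fun p => T p.1 (z p.1) p.2

/-- The `(i, j)` block of a matrix indexed by sigma types. -/
def block {d : ℕ} {k k' : Fin d → ℕ} (M : Matrix (Σ i, Fin (k i)) (Σ i, Fin (k' i)) ℝ)
    (i j : Fin d) : Matrix (Fin (k i)) (Fin (k' j)) ℝ :=
  Matrix.of fun a b => M ⟨i, a⟩ ⟨j, b⟩

theorem StronglyExponential.eq_zero_of_const {k : ℕ} {T : ℝ → (Fin k → ℝ)}
    (hT : StronglyExponential T) {η : Fin k → ℝ} {p q : ℝ} (hpq : p < q) {c : ℝ}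
    (h : ∀ u ∈ Set.Icc p q, T u ⬝ᵥ η = c) : η = 0 := by
  refine (hT (Set.Icc p q) η ⟨c, h⟩).resolve_left ?_
  simp [Real.volume_Icc, hpq]

theorem hasDerivAt_dotProduct {k : ℕ} {T : ℝ → (Fin k → ℝ)} (hd : Differentiable ℝ T)
    (η : Fin k → ℝ) (u : ℝ) : HasDerivAt (fun u => T u ⬝ᵥ η) (deriv T u ⬝ᵥ η) u := by
  have h := hasDerivAt_pi.1 (hd u).hasDerivAt
  exact HasDerivAt.fun_sum fun a _ => (h a).mul_const (η a)

theorem StronglyExponential.eq_zero_of_deriv {k : ℕ} {T : ℝ → (Fin k → ℝ)}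
    (hT : StronglyExponential T) (hd : Differentiable ℝ T) {η : Fin k → ℝ} {p q : ℝ} (hpq : p < q)
    (h : ∀ u ∈ Set.Icc p q, deriv T u ⬝ᵥ η = 0) : η = 0 := by
  refine hT.eq_zero_of_const hpq (c := T p ⬝ᵥ η) fun u hu => ?_
  refine constant_of_has_deriv_right_zero (f := fun u => T u ⬝ᵥ η)
    (fun u _ => (hasDerivAt_dotProduct hd η u).continuousAt.continuousWithinAt)
    (fun u hu => ?_) u hu
  have := (hasDerivAt_dotProduct hd η u).hasDerivWithinAt (s := Set.Ici u)
  rwa [h u (Set.Ico_subset_Icc_self hu)] at this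

theorem concat_const {d : ℕ} {k : Fin d → ℕ} {T : (i : Fin d) → ℝ → (Fin (k i) → ℝ)}
    (hT : ∀ i, StronglyExponential (T i)) {η : (Σ i, Fin (k i)) → ℝ} {c : ℝ}
    (h : ∀ z, η ⬝ᵥ concat T z = c) : η = 0 := by
  have key : ∀ i, (fun a => η ⟨i, a⟩) = 0 := fun i => by
    refine (hT i).eq_zero_of_const (p := 0) (q := 1) one_pos
      (c := T i 0 ⬝ᵥ (fun a => η ⟨i, a⟩)) fun u _ => ?_
    have h1 := (h (Function.update 0 i u)).trans (h 0).symm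
    simp only [dotProduct, concat, Fintype.sum_sigma] at h1
    rw [← Finset.add_sum_erase _ _ (Finset.mem_univ i),
      ← Finset.add_sum_erase _ _ (Finset.mem_univ i)] at h1
    have h2 : ∀ x ∈ Finset.univ.erase i,
        ∑ a, η ⟨x, a⟩ * T x ((Function.update 0 i u : Fin d → ℝ) x) a =
        ∑ a, η ⟨x, a⟩ * T x ((0 : Fin d → ℝ) x) a := fun x hx => by
      rw [Function.update_of_ne (Finset.ne_of_mem_erase hx)]
    rw [Finset.sum_congr rfl h2] at h1
    have h3 := add_right_cancel h1
    simpa [dotProduct, mul_comm] using h3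
  funext ⟨i, a⟩
  exact congrFun (key i) a

/-- Substituting one relation into the other makes each row of `M * M' - 1` pair with `concat T` to
a constant. Equality of the total dimensions is not presupposed, so `M' * M = 1` needs a second
application. -/
theorem mul_eq_one_of_concat {d : ℕ} {k k' : Fin d → ℕ} {T : (i : Fin d) → ℝ → (Fin (k i) → ℝ)}
    {T' : (i : Fin d) → ℝ → (Fin (k' i) → ℝ)} (hT : ∀ i, StronglyExponential (T i))
    {φ : (Fin d → ℝ) → (Fin d → ℝ)}
    {M : Matrix (Σ i, Fin (k i)) (Σ i, Fin (k' i)) ℝ} {b : (Σ i, Fin (k i)) → ℝ}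
    {M' : Matrix (Σ i, Fin (k' i)) (Σ i, Fin (k i)) ℝ} {b' : (Σ i, Fin (k' i)) → ℝ}
    (h : ∀ z, concat T z = M *ᵥ concat T' (φ z) + b)
    (h' : ∀ z, concat T' (φ z) = M' *ᵥ concat T z + b') : M * M' = 1 := by
  rw [← sub_eq_zero]
  refine Matrix.ext fun r => ?_
  refine fun s => congrFun (concat_const hT (η := (M * M' - 1 : Matrix (Σ i, Fin (k i)) (Σ i, Fin (k i)) ℝ) r)
    (c := - (M *ᵥ b' + b) r) fun z => ?_) s
  have h1 := h z
  rw [h' z, mulVec_add, mulVec_mulVec] at h1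
  have h2 : ((M * M' - 1) *ᵥ concat T z) r = - (M *ᵥ b' + b) r := by
    have := congrFun h1 r
    simp only [sub_mulVec, one_mulVec, Pi.sub_apply, Pi.add_apply] at this ⊢
    linarith
  exact h2

/-! ### Block structure -/

theorem mulVec_sigma {d : ℕ} {k k' : Fin d → ℕ} (M : Matrix (Σ i, Fin (k i)) (Σ i, Fin (k' i)) ℝ)
    (v : (Σ i, Fin (k' i)) → ℝ) (i : Fin d) (a : Fin (k i)) :
    (M *ᵥ v) ⟨i, a⟩ = ∑ j, (block M i j *ᵥ fun b => v ⟨j, b⟩) a := by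
  simp [mulVec, dotProduct, Fintype.sum_sigma, block]

theorem block_mul {d : ℕ} {k k' k'' : Fin d → ℕ}
    (M : Matrix (Σ i, Fin (k i)) (Σ i, Fin (k' i)) ℝ)
    (N : Matrix (Σ i, Fin (k' i)) (Σ i, Fin (k'' i)) ℝ) (i l : Fin d) :
    block (M * N) i l = ∑ j, block M i j * block N j l := by
  ext a b
  simp [Matrix.mul_apply, Fintype.sum_sigma, block, Matrix.sum_apply]

theorem block_one_self {d : ℕ} {k : Fin d → ℕ} (i : Fin d) :
    block (1 : Matrix (Σ i, Fin (k i)) (Σ i, Fin (k i)) ℝ) i i = 1 := by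
  ext a b
  simp [block, Matrix.one_apply]

theorem exists_block_ne_zero {d : ℕ} {k k' : Fin d → ℕ}
    {M : Matrix (Σ i, Fin (k i)) (Σ i, Fin (k' i)) ℝ}
    {M' : Matrix (Σ i, Fin (k' i)) (Σ i, Fin (k i)) ℝ} (h : M * M' = 1) {i : Fin d}
    (hk : 0 < k i) : ∃ j, block M i j ≠ 0 ∧ block M' j i ≠ 0 := by
  by_contra! hc
  have h1 := block_mul M M' i i
  rw [h, block_one_self, Finset.sum_eq_zero] at h1
  · have : Nonempty (Fin (k i)) := ⟨⟨0, hk⟩⟩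
    exact one_ne_zero h1
  · intro j _
    by_cases hj : block M i j = 0
    · rw [hj, Matrix.zero_mul]
    · rw [hc j hj, Matrix.mul_zero]

/-- A nonzero diagonal block of `M * M'` picks out `γ i`, and one of `M' * M` shows that every
column is hit. Once the other blocks vanish, the block products collapse to a single term. -/
theorem exists_perm_of_block {d : ℕ} {k k' : Fin d → ℕ} (hk : ∀ i, 0 < k i) (hk' : ∀ i, 0 < k' i)
    {M : Matrix (Σ i, Fin (k i)) (Σ i, Fin (k' i)) ℝ}
    {M' : Matrix (Σ i, Fin (k' i)) (Σ i, Fin (k i)) ℝ} (h : M * M' = 1) (h' : M' * M = 1)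
    (huniq : ∀ i j l, block M i j ≠ 0 → block M i l ≠ 0 → j = l) :
    ∃ γ : Equiv.Perm (Fin d), ∀ i, (∀ j, j ≠ γ i → block M i j = 0) ∧
      block M i (γ i) * block M' (γ i) i = 1 ∧ block M' (γ i) i * block M i (γ i) = 1 := by
  choose γ hγ hγ' using fun i => exists_block_ne_zero h (hk i)
  have hsurj : Function.Surjective γ := fun j => by
    obtain ⟨i, -, hi⟩ := exists_block_ne_zero h' (hk' j)
    exact ⟨i, huniq i _ _ (hγ i) hi⟩
  have hbij : Function.Bijective γ := Finite.surjective_iff_bijective.1 hsurj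
  have hzero : ∀ i j, j ≠ γ i → block M i j = 0 := fun i j hj => by
    by_contra hne
    exact hj (huniq i _ _ hne (hγ i))
  refine ⟨Equiv.ofBijective γ hbij, fun i => ⟨hzero i, ?_, ?_⟩⟩
  · have h1 := block_mul M M' i i
    rw [h, block_one_self, Finset.sum_eq_single_of_mem (γ i) (Finset.mem_univ _)] at h1
    · exact h1.symm
    · intro j _ hj
      rw [hzero i j hj, Matrix.zero_mul]
  · have h1 := block_mul M' M (γ i) (γ i)
    rw [h', block_one_self, Finset.sum_eq_single_of_mem i (Finset.mem_univ _)] at h1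
    · exact h1.symm
    · intro j _ hj
      rw [hzero j (γ i) fun he => hj (hbij.1 he).symm, Matrix.mul_zero]

/-! ### Rigidity of the latent transition map -/

/-- Chain rule in the coordinate `z m`, with `c` the partial derivative of `ψ_i`. The direction on
the right does not depend on `m`. -/
theorem block_mulVec_deriv {d : ℕ} {k k' : Fin d → ℕ} {T : (i : Fin d) → ℝ → (Fin (k i) → ℝ)}
    {T' : (i : Fin d) → ℝ → (Fin (k' i) → ℝ)} (hd : ∀ i, Differentiable ℝ (T i))
    (hd' : ∀ i, Differentiable ℝ (T' i))
    {ψ : (Fin d → ℝ) → (Fin d → ℝ)} (hψ : Differentiable ℝ ψ)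
    {M : Matrix (Σ i, Fin (k i)) (Σ i, Fin (k' i)) ℝ} {b : (Σ i, Fin (k i)) → ℝ}
    (h : ∀ z, concat T (ψ z) = M *ᵥ concat T' z + b) (z : Fin d → ℝ) (i m : Fin d) :
    ∃ c : ℝ, block M i m *ᵥ deriv (T' m) (z m) = c • deriv (T i) (ψ z i) := by
  have hu : HasDerivAt (fun u => Function.update z m u) (Pi.single m 1) (z m) :=
    hasDerivAt_update z m (z m)
  have hψu : HasDerivAt (fun u => ψ (Function.update z m u) i)
      (fderiv ℝ ψ z (Pi.single m 1) i) (z m) := by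
    have h1 : HasFDerivAt ψ (fderiv ℝ ψ z) (Function.update z m (z m)) := by
      rw [Function.update_eq_self]; exact (hψ z).hasFDerivAt
    exact hasDerivAt_pi.1 (h1.comp_hasDerivAt _ hu) i
  refine ⟨fderiv ℝ ψ z (Pi.single m 1) i, funext fun a => ?_⟩
  have hl : HasDerivAt (fun u => T i (ψ (Function.update z m u) i) a)
      (fderiv ℝ ψ z (Pi.single m 1) i * deriv (T i) (ψ z i) a) (z m) := by
    have h1 : HasDerivAt (T i) (deriv (T i) (ψ z i)) (ψ (Function.update z m (z m)) i) := by
      rw [Function.update_eq_self]; exact (hd i _).hasDerivAt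
    exact hasDerivAt_pi.1
      (HasDerivAt.scomp (h := fun u => ψ (Function.update z m u) i) (z m) h1 hψu) a
  have hr : HasDerivAt (fun u => T i (ψ (Function.update z m u) i) a)
      ((block M i m *ᵥ deriv (T' m) (z m)) a) (z m) := by
    have h2 : (fun u => T i (ψ (Function.update z m u) i) a) = fun u =>
        T' m u ⬝ᵥ block M i m a +
          (∑ j ∈ Finset.univ.erase m, (block M i j *ᵥ T' j (z j)) a + b ⟨i, a⟩) := by
      funext u
      have := congrFun (h (Function.update z m u)) ⟨i, a⟩
      rw [Pi.add_apply, mulVec_sigma, ← Finset.add_sum_erase _ _ (Finset.mem_univ m)] at this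
      rw [← add_assoc]
      refine this.trans ?_
      congr 2
      · simp only [concat, Function.update_self]
        rw [dotProduct_comm]; rfl
      · refine Finset.sum_congr rfl fun j hj => ?_
        simp only [concat, Function.update_of_ne (Finset.ne_of_mem_erase hj)]
    rw [h2, mulVec, dotProduct_comm]
    exact (hasDerivAt_dotProduct (hd' m) _ _).add_const _
  rw [Pi.smul_apply, smul_eq_mul]
  exact hr.unique hl

theorem exists_block_mulVec_deriv_ne_zero {d : ℕ} {k k' : Fin d → ℕ}
    {T' : (i : Fin d) → ℝ → (Fin (k' i) → ℝ)} (hT' : ∀ i, StronglyExponential (T' i))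
    (hd' : ∀ i, Differentiable ℝ (T' i)) {M : Matrix (Σ i, Fin (k i)) (Σ i, Fin (k' i)) ℝ}
    {i j : Fin d} (h : block M i j ≠ 0) : ∃ u, block M i j *ᵥ deriv (T' j) u ≠ 0 := by
  by_contra! hc
  refine h (funext fun a => (hT' j).eq_zero_of_deriv (hd' j) one_pos fun u _ => ?_)
  rw [dotProduct_comm]
  exact congrFun (hc u) a

theorem exists_ne_zero_dotProduct_eq_zero {k : ℕ} (hk : 2 ≤ k) (e : Fin k → ℝ) :
    ∃ η : Fin k → ℝ, η ≠ 0 ∧ η ⬝ᵥ e = 0 := by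
  let p : Fin k := ⟨0, by omega⟩
  let q : Fin k := ⟨1, by omega⟩
  have hpq : p ≠ q := by simp [p, q]
  by_cases hp : e p = 0
  · exact ⟨Pi.single p 1, by simp, by simp [hp]⟩
  · refine ⟨Pi.single q (e p) - Pi.single p (e q), fun h0 => hp ?_, ?_⟩
    · simpa [hpq] using congrFun h0 q
    · simp [sub_dotProduct, mul_comm]

theorem block_unique_of_two_le {d : ℕ} {k k' : Fin d → ℕ} (hk : ∀ i, 2 ≤ k i)
    {T : (i : Fin d) → ℝ → (Fin (k i) → ℝ)} {T' : (i : Fin d) → ℝ → (Fin (k' i) → ℝ)}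
    (hT' : ∀ i, StronglyExponential (T' i)) (hd : ∀ i, Differentiable ℝ (T i))
    (hd' : ∀ i, Differentiable ℝ (T' i))
    {ψ : (Fin d → ℝ) → (Fin d → ℝ)} (hψ : Differentiable ℝ ψ)
    {M : Matrix (Σ i, Fin (k i)) (Σ i, Fin (k' i)) ℝ}
    {M' : Matrix (Σ i, Fin (k' i)) (Σ i, Fin (k i)) ℝ} (hM : M * M' = 1)
    {b : (Σ i, Fin (k i)) → ℝ} (h : ∀ z, concat T (ψ z) = M *ᵥ concat T' z + b)
    (i j l : Fin d) (hj : block M i j ≠ 0) (hl : block M i l ≠ 0) : j = l := by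
  by_contra hjl
  have hpar := block_mulVec_deriv hd hd' hψ h
  have step : ∀ (η : Fin (k i) → ℝ) (s : Fin d) (u : ℝ), block M i s *ᵥ deriv (T' s) u ≠ 0 →
      η ⬝ᵥ (block M i s *ᵥ deriv (T' s) u) = 0 →
      ∀ m, m ≠ s → ∀ v, η ⬝ᵥ (block M i m *ᵥ deriv (T' m) v) = 0 := by
    intro η s u hne horth m hms v
    -- At this point both relations share the vector `deriv (T i) (ψ z i)`; the first has a nonzero
    -- scalar, so `η` annihilates that vector and hence the second side too.
    set z : Fin d → ℝ := Function.update (fun _ => v) s u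
    obtain ⟨c, hc⟩ := hpar z i s
    obtain ⟨c', hc'⟩ := hpar z i m
    rw [show z s = u from Function.update_self ..] at hc
    rw [show z m = v from Function.update_of_ne hms ..] at hc'
    rw [hc] at hne horth
    rw [dotProduct_smul] at horth
    rw [hc', dotProduct_smul, (smul_eq_zero.1 horth).resolve_left fun h0 => hne (by simp [h0]),
      smul_zero]
  obtain ⟨u, hu⟩ := exists_block_mulVec_deriv_ne_zero hT' hd' hj
  obtain ⟨v, hv⟩ := exists_block_mulVec_deriv_ne_zero hT' hd' hl
  obtain ⟨η, hη, hηu⟩ := exists_ne_zero_dotProduct_eq_zero (hk i) (block M i j *ᵥ deriv (T' j) u)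
  have hj' := step η j u hu hηu
  -- Starting again from `l` covers the block `j` itself, which the first application leaves out.
  have hl' := step η l v hv (hj' l (Ne.symm hjl) v)
  have hall : ∀ m w, η ⬝ᵥ (block M i m *ᵥ deriv (T' m) w) = 0 := fun m w => by
    by_cases hm : m = j
    · exact hl' m (hm ▸ hjl) w
    · exact hj' m hm w
  have hrow : ∀ m, η ᵥ* block M i m = 0 := fun m =>
    (hT' m).eq_zero_of_deriv (hd' m) one_pos fun w _ => by
      rw [dotProduct_comm, ← dotProduct_mulVec]; exact hall m w
  apply hη
  -- `η` kills the whole block row `i` of `M`, which has a right inverse.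
  rw [← vecMul_one η, ← block_one_self (k := k) i, ← hM, block_mul, vecMul_sum]
  refine Finset.sum_eq_zero fun m _ => ?_
  rw [← vecMul_vecMul, hrow, zero_vecMul]

/-- Without critical points, Rolle gives injectivity, and a continuous injection of the line is
strictly monotone. -/
theorem exists_deriv_eq_zero_of_not_monotone {f : ℝ → ℝ} (hf : Differentiable ℝ f)
    (hm : ¬ Monotone f) (ha : ¬ Antitone f) : ∃ u, deriv f u = 0 := by
  by_contra! hc
  have hinj : Function.Injective f := by
    intro p q hpq
    by_contra hne
    rcases lt_or_gt_of_ne hne with hlt | hlt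
    · obtain ⟨c, -, h0⟩ := exists_deriv_eq_zero hlt hf.continuous.continuousOn hpq
      exact hc c h0
    · obtain ⟨c, -, h0⟩ := exists_deriv_eq_zero hlt hf.continuous.continuousOn hpq.symm
      exact hc c h0
  rcases hf.continuous.strictMono_of_inj hinj with h | h
  · exact hm h.monotone
  · exact ha h.antitone

theorem eq_of_fderiv_eq_zero_on_hyperplane {d : ℕ} {φ ψ : (Fin d → ℝ) → (Fin d → ℝ)}
    (hφ : Differentiable ℝ φ) (hψ : Differentiable ℝ ψ) (hφψ : Function.RightInverse ψ φ)
    (hψφ : Function.LeftInverse ψ φ) {z : Fin d → ℝ} {i j l : Fin d}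
    (hj : ∀ v : Fin d → ℝ, v i = 0 → fderiv ℝ φ z v j = 0)
    (hl : ∀ v : Fin d → ℝ, v i = 0 → fderiv ℝ φ z v l = 0) : j = l := by
  by_contra hjl
  have hinv : ∀ w, fderiv ℝ φ z (fderiv ℝ ψ (φ z) w) = w := by
    have h1 : HasFDerivAt φ (fderiv ℝ φ z) (ψ (φ z)) := by
      rw [hψφ z]; exact (hφ z).hasFDerivAt
    have h2 := h1.comp (φ z) (hψ (φ z)).hasFDerivAt
    rw [hφψ.id] at h2
    intro w
    exact DFunLike.congr_fun (h2.unique (hasFDerivAt_id _)) w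
  set v := fderiv ℝ ψ (φ z) (Pi.single j 1) with hv
  set w := fderiv ℝ ψ (φ z) (Pi.single l 1) with hw
  have hvi : v i = 0 := by
    -- This combination lies in the hyperplane, and the `l`-th coordinate of its image is `v i`.
    have := hl (v i • w - w i • v) (by simp [mul_comm])
    rw [map_sub, map_smul, map_smul, hv, hw, hinv, hinv] at this
    simpa [Ne.symm hjl] using this
  have := hj v hvi
  rw [hv, hinv] at this
  simp at this

theorem block_unique_of_deriv_eq_zero {d : ℕ} {k k' : Fin d → ℕ}
    {T : (i : Fin d) → ℝ → (Fin (k i) → ℝ)} {T' : (i : Fin d) → ℝ → (Fin (k' i) → ℝ)}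
    (hcrit : ∀ i, ∃ u, deriv (T i) u = 0)
    (hT' : ∀ i, StronglyExponential (T' i)) (hd : ∀ i, Differentiable ℝ (T i))
    (hd' : ∀ i, Differentiable ℝ (T' i)) {φ ψ : (Fin d → ℝ) → (Fin d → ℝ)}
    (hφ : Differentiable ℝ φ) (hψ : Differentiable ℝ ψ) (hφψ : Function.RightInverse ψ φ)
    (hψφ : Function.LeftInverse ψ φ)
    {M : Matrix (Σ i, Fin (k i)) (Σ i, Fin (k' i)) ℝ}
    {b : (Σ i, Fin (k i)) → ℝ} (h : ∀ z, concat T (ψ z) = M *ᵥ concat T' z + b)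
    (i j l : Fin d) (hj : block M i j ≠ 0) (hl : block M i l ≠ 0) : j = l := by
  obtain ⟨u, hu⟩ := hcrit i
  have hconv : IsPreconnected {z : Fin d → ℝ | z i = u} :=
    (convex_hyperplane (LinearMap.proj (R := ℝ) (φ := fun _ => ℝ) i).isLinear u).isPreconnected
  have hconst : ∀ m, block M i m ≠ 0 → ∀ z z' : Fin d → ℝ, z i = u → z' i = u →
      ¬ φ z m < φ z' m := by
    intro m hm z z' hz hz' hlt
    obtain ⟨a, ha⟩ := Function.ne_iff.1 hm
    refine ha ((hT' m).eq_zero_of_deriv (hd' m) hlt fun w hw => ?_)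
    have hcont : ContinuousOn (fun z => φ z m) {z : Fin d → ℝ | z i = u} :=
      ((continuous_apply m).comp hφ.continuous).continuousOn
    -- The hyperplane is connected, so `φ_m` takes every intermediate value on it; there `T_i` is
    -- critical and `M_im T'_m'` vanishes.
    obtain ⟨y, hy, rfl⟩ := (hconv.image _ hcont).Icc_subset ⟨z, hz, rfl⟩ ⟨z', hz', rfl⟩ hw
    obtain ⟨c, hc⟩ := block_mulVec_deriv hd hd' hψ h (φ y) i m
    rw [hψφ y, show y i = u from hy, hu, smul_zero] at hc
    rw [dotProduct_comm]
    exact congrFun hc a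
  have hder : ∀ m, block M i m ≠ 0 → ∀ v : Fin d → ℝ, v i = 0 →
      fderiv ℝ φ (fun _ => u) v m = 0 := by
    intro m hm v hv
    have h1 : HasDerivAt (fun t : ℝ => (fun _ => u) + t • v) v 0 := by
      simpa using ((hasDerivAt_id (0 : ℝ)).smul_const v).const_add (fun _ => u)
    have h2 : HasFDerivAt φ (fderiv ℝ φ (fun _ => u)) ((fun _ => u) + (0 : ℝ) • v) := by
      rw [zero_smul, add_zero]; exact (hφ _).hasFDerivAt
    have h3 := hasDerivAt_pi.1 (h2.comp_hasDerivAt _ h1) m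
    have h4 : (fun t : ℝ => (φ ∘ fun t : ℝ => (fun _ => u) + t • v) t m) =
        fun _ => φ (fun _ => u) m := by
      funext t
      have ht : ((fun _ => u) + t • v : Fin d → ℝ) i = u := by simp [hv]
      exact le_antisymm (not_lt.1 (hconst m hm _ _ rfl ht)) (not_lt.1 (hconst m hm _ _ ht rfl))
    rw [h4] at h3
    exact h3.unique (hasDerivAt_const _ _)
  exact eq_of_fderiv_eq_zero_on_hyperplane hφ hψ hφψ hψφ (hder j hj) (hder l hl)

/-! ### Equal observed laws -/

theorem map_withDensity_comp {α β : Type*} [MeasurableSpace α] [MeasurableSpace β]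
    {ν : Measure α} {h : α → β} {g : β → α} (hh : Measurable h) (hg : Measurable g)
    (hgh : Function.LeftInverse g h) {r : α → ENNReal} (hr : Measurable r) :
    (ν.withDensity r).map h = (ν.map h).withDensity (r ∘ g) := by
  ext s hs
  rw [Measure.map_apply hh hs, withDensity_apply _ (hh hs), withDensity_apply _ hs,
    setLIntegral_map hs (hr.comp hg) hh]
  simp only [Function.comp_apply, hgh _]

namespace Parameters

variable {d : ℕ} {Y : Type*}

theorem exponent_eq (θ : Parameters d Y) (z : Fin d → ℝ) (y : Y) :
    θ.exponent z y = concat θ.stat z ⬝ᵥ fun p => θ.natParam p.1 y p.2 := by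
  simp [exponent, dotProduct, concat, Fintype.sum_sigma]

theorem fullNatParam_finSigmaFinEquiv (θ : Parameters d Y) (y : Y) (p : Σ i, Fin (θ.dim i)) :
    θ.fullNatParam y (finSigmaFinEquiv p) = θ.natParam p.1 y p.2 :=
  congrArg (fun q : Σ i, Fin (θ.dim i) => θ.natParam q.1 y q.2)
    (finSigmaFinEquiv.symm_apply_apply p)

theorem continuous_exponent {θ : Parameters d Y} (hd : ∀ i, Differentiable ℝ (θ.stat i)) (y : Y) :
    Continuous fun z => θ.exponent z y := by
  refine continuous_finsetSum _ fun i _ => ?_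
  exact (((hd i).continuous.comp (continuous_apply i))).dotProduct continuous_const

/-- The logarithm of the likelihood ratio of two values of the auxiliary variable. -/
noncomputable def logRatio (θ : Parameters d Y) (y y₀ : Y) (z : Fin d → ℝ) : ℝ :=
  (θ.exponent z y - θ.logNormalizer y) - (θ.exponent z y₀ - θ.logNormalizer y₀)

theorem continuous_logRatio {θ : Parameters d Y} (hd : ∀ i, Differentiable ℝ (θ.stat i))
    (y y₀ : Y) : Continuous (θ.logRatio y y₀) :=
  ((continuous_exponent hd y).sub continuous_const).sub
    ((continuous_exponent hd y₀).sub continuous_const)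

theorem measurable_latentDensity {θ : Parameters d Y} (hm : θ.IsModel)
    (hd : ∀ i, Differentiable ℝ (θ.stat i)) (y : Y) : Measurable (θ.latentDensity y) :=
  hm.2.1.mul (Real.measurable_exp.comp ((continuous_exponent hd y).measurable.sub_const _))

theorem latentLaw_eq_withDensity {θ : Parameters d Y} (hm : θ.IsModel)
    (hd : ∀ i, Differentiable ℝ (θ.stat i)) (y y₀ : Y) :
    θ.latentLaw y =
      (θ.latentLaw y₀).withDensity fun z => ENNReal.ofReal (Real.exp (θ.logRatio y y₀ z)) := by
  have hr : Measurable fun z => ENNReal.ofReal (Real.exp (θ.logRatio y y₀ z)) :=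
    (Real.measurable_exp.comp (continuous_logRatio hd y y₀).measurable).ennreal_ofReal
  rw [latentLaw, latentLaw, ← withDensity_mul _ (measurable_latentDensity hm hd y₀).ennreal_ofReal
    hr]
  congr 1
  funext z
  rw [Pi.mul_apply, ← ENNReal.ofReal_mul' (Real.exp_pos _).le, latentDensity, latentDensity,
    mul_assoc, ← Real.exp_add, logRatio]
  congr 3
  ring

theorem volume_absolutelyContinuous_latentLaw {θ : Parameters d Y} (hm : θ.IsModel)
    (hd : ∀ i, Differentiable ℝ (θ.stat i)) (y : Y) : volume ≪ θ.latentLaw y := by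
  refine withDensity_absolutelyContinuous'
    (measurable_latentDensity hm hd y).ennreal_ofReal.aemeasurable ?_
  filter_upwards [hm.2.2.1] with z hz
  exact (ENNReal.ofReal_pos.2 (mul_pos hz (Real.exp_pos _))).ne'

theorem isFiniteMeasure_latentLaw {θ : Parameters d Y} (hm : θ.IsModel) (y : Y) :
    IsFiniteMeasure (θ.latentLaw y) := by
  refine isFiniteMeasure_withDensity_ofReal (Integrable.hasFiniteIntegral ?_)
  have h := (hm.2.2.2 y).mul_const (Real.exp (-θ.logNormalizer y))
  refine h.congr (Filter.Eventually.of_forall fun z => ?_)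
  simp only [latentDensity, sub_eq_add_neg, Real.exp_add, mul_assoc]

/-- Each law at `y` is a density against the law at `y₀`, so no Jacobian appears: uniqueness of
densities over the common observed law at `y₀` suffices. -/
theorem logRatio_eq {θ θ' : Parameters d Y} (hm : θ.IsModel) (hm' : θ'.IsModel)
    (hd : ∀ i, Differentiable ℝ (θ.stat i)) (hd' : ∀ i, Differentiable ℝ (θ'.stat i))
    {g g' : (Fin d → ℝ) → (Fin d → ℝ)} (hg : Function.LeftInverse g θ.mixing)
    (hg' : Function.LeftInverse g' θ'.mixing) (hc : Continuous θ.mixing) (hcg : Continuous g)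
    (hcg' : Continuous g') (heq : ∀ y, θ.observedLaw y = θ'.observedLaw y) (y y₀ : Y)
    (z : Fin d → ℝ) : θ.logRatio y y₀ z = θ'.logRatio y y₀ (g' (θ.mixing z)) := by
  have hr := continuous_logRatio hd y y₀
  have hr' := continuous_logRatio hd' y y₀
  have hmr : Measurable fun z => ENNReal.ofReal (Real.exp (θ.logRatio y y₀ z)) :=
    (Real.measurable_exp.comp hr.measurable).ennreal_ofReal
  have hmr' : Measurable fun z => ENNReal.ofReal (Real.exp (θ'.logRatio y y₀ z)) :=
    (Real.measurable_exp.comp hr'.measurable).ennreal_ofReal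
  have h1 := heq y
  rw [observedLaw, observedLaw, latentLaw_eq_withDensity hm hd y y₀,
    latentLaw_eq_withDensity hm' hd' y y₀, map_withDensity_comp hm.1 hcg.measurable hg hmr,
    map_withDensity_comp hm'.1 hcg'.measurable hg' hmr'] at h1
  change (θ.observedLaw y₀).withDensity _ = (θ'.observedLaw y₀).withDensity _ at h1
  rw [← heq y₀] at h1
  have : IsFiniteMeasure (θ.latentLaw y₀) := isFiniteMeasure_latentLaw hm y₀
  have : IsFiniteMeasure (θ.observedLaw y₀) := by unfold observedLaw; infer_instance
  rw [withDensity_eq_iff_of_sigmaFinite (hmr.comp hcg.measurable).aemeasurable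
    (hmr'.comp hcg'.measurable).aemeasurable] at h1
  -- Almost everywhere positivity of the base density transfers the equality to Lebesgue measure,
  -- where continuity upgrades it to all points.
  have h2 := (volume_absolutelyContinuous_latentLaw hm hd y₀).ae_le
    (ae_of_ae_map hm.1.aemeasurable h1)
  have h3 : θ.logRatio y y₀ =ᵐ[volume] fun z => θ'.logRatio y y₀ (g' (θ.mixing z)) := by
    filter_upwards [h2] with z hz
    simp only [Function.comp_apply, hg z] at hz
    exact Real.exp_injective
      ((ENNReal.ofReal_eq_ofReal_iff (Real.exp_pos _).le (Real.exp_pos _).le).1 hz)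
  exact congrFun ((hr.ae_eq_iff_eq volume (hr'.comp (hcg'.comp hc))).1 h3) z

theorem exists_concat_eq {θ θ' : Parameters d Y} {φ : (Fin d → ℝ) → (Fin d → ℝ)}
    (hv : ∃ y : Fin (θ.totalDim + 1) → Y, Function.Injective y ∧ IsUnit (θ.variabilityMatrix y))
    (h : ∀ y y₀ z, θ.logRatio y y₀ z = θ'.logRatio y y₀ (φ z)) :
    ∃ (M : Matrix (Σ i, Fin (θ.dim i)) (Σ i, Fin (θ'.dim i)) ℝ) (b : (Σ i, Fin (θ.dim i)) → ℝ),
      ∀ z, concat θ.stat z = M *ᵥ concat θ'.stat (φ z) + b := by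
  obtain ⟨y, -, hy⟩ := hv
  obtain ⟨K, hK⟩ := hy.exists_right_inv
  let L : Matrix (Σ i, Fin (θ.dim i)) (Fin θ.totalDim) ℝ :=
    (θ.variabilityMatrix y).submatrix finSigmaFinEquiv id
  let K' : Matrix (Fin θ.totalDim) (Σ i, Fin (θ.dim i)) ℝ := K.submatrix id finSigmaFinEquiv
  let L' : Matrix (Σ i, Fin (θ'.dim i)) (Fin θ.totalDim) ℝ :=
    Matrix.of fun p l => θ'.natParam p.1 (y l.succ) p.2 - θ'.natParam p.1 (y 0) p.2
  -- The normalizers do not depend on `z` and end up in the offset `b`.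
  let c : Fin θ.totalDim → ℝ := fun l =>
    θ.logNormalizer (y l.succ) - θ.logNormalizer (y 0) -
      (θ'.logNormalizer (y l.succ) - θ'.logNormalizer (y 0))
  have hLK : L * K' = 1 := by
    have := Matrix.submatrix_mul (θ.variabilityMatrix y) K finSigmaFinEquiv id finSigmaFinEquiv
      Function.bijective_id
    rw [hK] at this
    rw [← this]
    exact Matrix.submatrix_one_equiv _
  have hL : ∀ z, concat θ.stat z ᵥ* L = concat θ'.stat (φ z) ᵥ* L' + c := fun z => by
    funext l
    have h1 := h (y l.succ) (y 0) z
    simp only [logRatio, exponent_eq] at h1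
    have h2 : (concat θ.stat z ᵥ* L) l =
        (concat θ.stat z ⬝ᵥ fun p => θ.natParam p.1 (y l.succ) p.2) -
          concat θ.stat z ⬝ᵥ fun p => θ.natParam p.1 (y 0) p.2 := by
      rw [← dotProduct_sub, vecMul]
      congr 1
      funext p
      exact congrArg₂ (· - ·) (fullNatParam_finSigmaFinEquiv θ (y l.succ) p)
        (fullNatParam_finSigmaFinEquiv θ (y 0) p)
    have h3 : (concat θ'.stat (φ z) ᵥ* L') l =
        (concat θ'.stat (φ z) ⬝ᵥ fun p => θ'.natParam p.1 (y l.succ) p.2) -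
          concat θ'.stat (φ z) ⬝ᵥ fun p => θ'.natParam p.1 (y 0) p.2 := by
      rw [← dotProduct_sub]; rfl
    rw [Pi.add_apply, h2, h3]
    simp only [c]
    linarith
  refine ⟨(L' * K')ᵀ, c ᵥ* K', fun z => ?_⟩
  rw [mulVec_transpose, ← vecMul_vecMul, ← add_vecMul, ← hL, vecMul_vecMul, hLK, vecMul_one]

/-- The statistics of two models with the same observed laws are related by an invertible affine
map. -/
theorem exists_affine {θ θ' : Parameters d Y} (hw : θ.WeakAssumptions) (hw' : θ'.WeakAssumptions)
    {g g' : (Fin d → ℝ) → (Fin d → ℝ)} (hg : Function.LeftInverse g θ.mixing)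
    (hg' : Function.LeftInverse g' θ'.mixing)
    (hgr' : Function.RightInverse g' θ'.mixing) (hc : Continuous θ.mixing)
    (hcg : Continuous g) (hcg' : Continuous g')
    (heq : ∀ y, θ.observedLaw y = θ'.observedLaw y) :
    ∃ (M : Matrix (Σ i, Fin (θ.dim i)) (Σ i, Fin (θ'.dim i)) ℝ)
      (M' : Matrix (Σ i, Fin (θ'.dim i)) (Σ i, Fin (θ.dim i)) ℝ) (b : (Σ i, Fin (θ.dim i)) → ℝ),
      M * M' = 1 ∧ M' * M = 1 ∧
        ∀ z, concat θ.stat (g (θ'.mixing z)) = M *ᵥ concat θ'.stat z + b := by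
  have h := logRatio_eq hw.isModel hw'.isModel hw.differentiable hw'.differentiable hg hg' hc hcg
    hcg' heq
  have hgr : Function.RightInverse g θ.mixing := hg.rightInverse_of_surjective hw.invertible.2
  have hinv : ∀ z, g' (θ.mixing (g (θ'.mixing z))) = z := fun z => by rw [hgr, hg']
  have h' : ∀ y y₀ z, θ'.logRatio y y₀ z = θ.logRatio y y₀ (g (θ'.mixing z)) := fun y y₀ z => by
    rw [h, hinv]
  obtain ⟨M, b, hM⟩ := exists_concat_eq hw.variability h
  obtain ⟨M', b', hM'⟩ := exists_concat_eq hw'.variability h'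
  have hN : ∀ z, concat θ.stat (g (θ'.mixing z)) = M *ᵥ concat θ'.stat z + b := fun z => by
    rw [hM, hinv]
  have hN' : ∀ z, concat θ'.stat (g' (θ.mixing z)) = M' *ᵥ concat θ.stat z + b' := fun z => by
    rw [hM', hgr', hg]
  exact ⟨M, M', b, mul_eq_one_of_concat hw.stronglyExponential hM hN',
    mul_eq_one_of_concat hw'.stronglyExponential hM' hN, hN⟩

theorem stronglyEquivalent_of_block_unique {θ θ' : Parameters d Y} (hk : ∀ i, 0 < θ.dim i)
    (hk' : ∀ i, 0 < θ'.dim i) {g : (Fin d → ℝ) → (Fin d → ℝ)}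
    (hg : Function.LeftInverse g θ.mixing)
    {M : Matrix (Σ i, Fin (θ.dim i)) (Σ i, Fin (θ'.dim i)) ℝ}
    {M' : Matrix (Σ i, Fin (θ'.dim i)) (Σ i, Fin (θ.dim i)) ℝ} {b : (Σ i, Fin (θ.dim i)) → ℝ}
    (hM : M * M' = 1) (hM' : M' * M = 1)
    (h : ∀ z, concat θ.stat (g (θ'.mixing z)) = M *ᵥ concat θ'.stat z + b)
    (huniq : ∀ i j l, block M i j ≠ 0 → block M i l ≠ 0 → j = l) : StronglyEquivalent θ θ' := by
  obtain ⟨γ, hγ⟩ := exists_perm_of_block hk hk' hM hM' huniq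
  refine ⟨γ, fun i => ⟨Matrix.toLin'OfInv (hγ i).2.2 (hγ i).2.1, fun a => b ⟨i, a⟩,
    fun z z' hzz' => funext fun a => ?_⟩⟩
  have h1 := congrFun (h z') ⟨i, a⟩
  rw [← hzz', hg, Pi.add_apply, mulVec_sigma,
    Finset.sum_eq_single_of_mem (γ i) (Finset.mem_univ _)] at h1
  · exact h1
  · intro j _ hj
    rw [(hγ i).1 j hj, zero_mulVec, Pi.zero_apply]

theorem exists_deriv_stat_eq_zero {θ : Parameters d Y} (hs : θ.ScalarAssumptions)
    (hd : ∀ i, Differentiable ℝ (θ.stat i)) (i : Fin d) : ∃ u, deriv (θ.stat i) u = 0 := by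
  obtain ⟨h1, h2⟩ := hs.1 i
  have hda : ∀ a, Differentiable ℝ fun u => θ.stat i u a := differentiable_pi.1 (hd i)
  have : Subsingleton (Fin (θ.dim i)) := by rw [h1]; infer_instance
  let a₀ : Fin (θ.dim i) := ⟨0, by omega⟩
  obtain ⟨u, hu⟩ := exists_deriv_eq_zero_of_not_monotone (hda a₀) (h2 a₀).1 (h2 a₀).2
  refine ⟨u, funext fun a => ?_⟩
  rw [deriv_pi fun a => hda a u, Subsingleton.elim a a₀]
  exact hu

end Parameters

end IMCA

theorem mainTheorem4 {d : ℕ} {Y : Type*} (Θ : Set (IMCA.Parameters d Y))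
    (hweak : ∀ θ ∈ Θ, θ.WeakAssumptions)
    (hstrong : (∀ θ ∈ Θ, θ.MultivariateAssumptions) ∨ (∀ θ ∈ Θ, θ.ScalarAssumptions)) :
    IMCA.Parameters.StronglyIdentifiable Θ := by
  intro θ hθ θ' hθ' heq
  have hw := hweak θ hθ
  have hw' := hweak θ' hθ'
  rcases hstrong with hs | hs
  · obtain ⟨hk, g, hg, -, hdh, hdg, -⟩ := hs θ hθ
    obtain ⟨hk', g', hg', hgr', hdh', hdg', -⟩ := hs θ' hθ'
    obtain ⟨M, M', b, hM, hM', h⟩ := IMCA.Parameters.exists_affine hw hw' hg hg' hgr'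
      hdh.continuous hdg.continuous hdg'.continuous heq
    exact IMCA.Parameters.stronglyEquivalent_of_block_unique
      (fun i => two_pos.trans_le (hk i).2.2) (fun i => two_pos.trans_le (hk' i).2.2) hg hM hM' h
      (IMCA.block_unique_of_two_le (fun i => (hk i).2.2) hw'.stronglyExponential hw.differentiable
        hw'.differentiable (ψ := fun z => g (θ'.mixing z)) (hdg.comp hdh') hM h)
  · obtain ⟨hk, g, hg, hgr, hch, hcg⟩ := hs θ hθ
    obtain ⟨hk', g', hg', hgr', hch', hcg'⟩ := hs θ' hθ'
    obtain ⟨M, M', b, hM, hM', h⟩ := IMCA.Parameters.exists_affine hw hw' hg hg' hgr'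
      hch.continuous hcg.continuous hcg'.continuous heq
    exact IMCA.Parameters.stronglyEquivalent_of_block_unique
      (fun i => (hk i).1 ▸ one_pos) (fun i => (hk' i).1 ▸ one_pos) hg hM hM' h
      (IMCA.block_unique_of_deriv_eq_zero
        (IMCA.Parameters.exists_deriv_stat_eq_zero (hs θ hθ) hw.differentiable)
        hw'.stronglyExponential hw.differentiable hw'.differentiable
        (φ := fun z => g' (θ.mixing z)) (ψ := fun z => g (θ'.mixing z))
        ((hcg'.differentiable one_ne_zero).comp (hch.differentiable one_ne_zero))
        ((hcg.differentiable one_ne_zero).comp (hch'.differentiable one_ne_zero))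
        (fun z => by simp only [hgr _, hg' _]) (fun z => by simp only [hgr' _, hg _]) h)
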